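/- Let $D=\{k/2^n : k,n\in\mathbb N\}$ be the set of non-negative dyadic numbers and let $(\Omega,\mathcal A,\mathbb P)$ be a probability space. A real process $B=(B(r))_{r\in D}$ is called a Brownian motion on $D$ if $B(0)=0$ a.s., $B(r)\sim\mathcal N(0,r)$ for $r\in D$, $B$ has independent increments, and $B(s)-B(r)$ has the same law as $B(s-r)$ for all $r\le s$ in $D$. (A) Let $(X_r)_{r\in D}$ be independent $\mathcal N(0,1)$ random variables on $\Omega$, and define $B$ on $D$ by $B(0)=0$, $B(k)=X_1+\dots+X_k$ for integers $k\ge 1$, and, for all $\ell,n\in\mathbb N$, $$B\Big(\frac{2\ell+1}{2^{n+1}}\Big)=\frac{B(\ell/2^n)+B((\ell+1)/2^n)}{2}+\frac{X_{(2\ell+1)/2^{n+1}}}{\sqrt{2^{n+2}}}.$$ Then $B$ is a Brownian motion on $D$. (B) Let $B$ be any Brownian motion on $D$ (for instance the process in (A)). For $k,n\in\mathbb N$ put $$M_{k,n}=\sup_{r\in D\cap[k/2^n,(k+2)/2^n]}\Big|B(r)-B\Big(\frac{k}{2^n}\Big)\Big|\in[0,\infty],\qquad M_n=\max_{0\le k\le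 (n+1)2^n}M_{k,n},$$ and let $N$ be the event that $M_n>1/n$ for infinitely many $n\geq 1$. Then: 1. $\mathbb P(N)=0$. 2. For every $\omega\notin N$: the map $r\mapsto B(r,\omega)$ is uniformly continuous on $D\cap[0,t]$ for every $t\ge 0$; the limit $\tilde B(t,\omega)=\lim_{D\ni r\downarrow t}B(r,\omega)$ (over $r\in D$, $r>t$) exists in $\mathbb R$ for every $t\ge0$; $\tilde B(r,\omega)=B(r,\omega)$ for every $r\in D$; and $t\mapsto\tilde B(t,\omega)$ is continuous on $[0,\infty)$. 3. Let $\tilde B(t,\omega)$ be a fixed real constant wherever the limit does not exist. Then $\tilde B=(\tilde B(t))_{t\ge0}$ has the same finite-dimensional laws as $B$ at times in $D$, and it is a standard Brownian motion: for all $t_1,\dots,t_k\ge 0$ the vector $(\tilde B(t_1),\dots,\tilde B(t_k))$ is centered Gaussian with covariances $\min(t_i,t_j)$, and almost every path of $\tilde B$ is continuous. -/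

import Mathlib

open MeasureTheory ProbabilityTheory Filter Topology
open scoped NNReal ENNReal

/-- The set `D = {k / 2 ^ n : k, n ∈ ℕ}` of non-negative dyadic numbers. -/
def dyadics : Set ℝ≥0 := {r | ∃ k n : ℕ, r = (k : ℝ≥0) / 2 ^ n}

/-- The dyadic number `k / 2 ^ n`, as an element of `D`. -/
noncomputable def dyad (k n : ℕ) : dyadics := ⟨(k : ℝ≥0) / 2 ^ n, k, n, rfl⟩

section Construction

variable {Ω : Type*}

/-- `levelValue X n k` is the value at time `k / 2 ^ n` of the process built from the family `X`,
by recursion on the level `n`: partial sums at integer times, then at each new midpoint the average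
of the two neighbouring values plus an independent term of standard deviation
`1 / √(2 ^ (n + 2))`. -/
noncomputable def levelValue (X : dyadics → Ω → ℝ) : ℕ → ℕ → Ω → ℝ
  | 0, k => fun ω => ∑ j ∈ Finset.range k, X (dyad (j + 1) 0) ω
  | n + 1, m => fun ω =>
      if Even m then levelValue X n (m / 2) ω
      else (levelValue X n (m / 2) ω + levelValue X n (m / 2 + 1) ω) / 2
        + X (dyad m (n + 1)) ω / √(2 ^ (n + 2))

/-- The process `B = (B(r))_{r ∈ D}` built from the family `X = (X_r)_{r ∈ D}`. The value does not
depend on the representation `r = k / 2 ^ n`, see `midpointProcess_dyad`. -/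
noncomputable def midpointProcess (X : dyadics → Ω → ℝ) (r : dyadics) : Ω → ℝ :=
  levelValue X r.2.choose_spec.choose r.2.choose

theorem levelValue_double (X : dyadics → Ω → ℝ) (n k : ℕ) :
    levelValue X (n + 1) (2 * k) = levelValue X n k := by
  funext ω
  simp [levelValue]

theorem levelValue_shift (X : dyadics → Ω → ℝ) (n k j : ℕ) :
    levelValue X (n + j) (k * 2 ^ j) = levelValue X n k := by
  induction j with
  | zero => simp
  | succ j ih =>
    have h : k * 2 ^ (j + 1) = 2 * (k * 2 ^ j) := by ring
    rw [h, ← add_assoc, levelValue_double, ih]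

theorem midpointProcess_dyad (X : dyadics → Ω → ℝ) (k n : ℕ) :
    midpointProcess X (dyad k n) = levelValue X n k := by
  have h := (dyad k n).2.choose_spec.choose_spec
  unfold midpointProcess
  generalize (dyad k n).2.choose_spec.choose = m at h ⊢
  generalize (dyad k n).2.choose = l at h ⊢
  have h' : (k : ℝ≥0) / 2 ^ n = (l : ℝ≥0) / 2 ^ m := h
  rw [div_eq_div_iff (by positivity) (by positivity)] at h'
  have h2 : k * 2 ^ m = l * 2 ^ n := by exact_mod_cast h'
  rw [← levelValue_shift X m l n, ← levelValue_shift X n k m, h2, add_comm]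

/-- Initial condition and partial sums at integer times. -/
theorem midpointProcess_nat (X : dyadics → Ω → ℝ) (k : ℕ) (ω : Ω) :
    midpointProcess X (dyad k 0) ω = ∑ j ∈ Finset.range k, X (dyad (j + 1) 0) ω := by
  rw [midpointProcess_dyad, levelValue]

/-- The midpoint recursion. -/
theorem midpointProcess_mid (X : dyadics → Ω → ℝ) (l n : ℕ) (ω : Ω) :
    midpointProcess X (dyad (2 * l + 1) (n + 1)) ω
      = (midpointProcess X (dyad l n) ω + midpointProcess X (dyad (l + 1) n) ω) / 2
        + X (dyad (2 * l + 1) (n + 1)) ω / √(2 ^ (n + 2)) := by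
  have h : (2 * l + 1) / 2 = l := by omega
  simp only [midpointProcess_dyad]
  rw [levelValue]
  simp [h]

end Construction

section Processes

variable {Ω : Type*} [MeasurableSpace Ω]

/-- `B` is a Brownian motion on the time set `D` of non-negative dyadic numbers (no regularity of
the paths is required). -/
structure IsDyadicBrownian (B : dyadics → Ω → ℝ) (P : Measure Ω) : Prop where
  initial : ∀ᵐ ω ∂P, B (dyad 0 0) ω = 0
  marginal : ∀ r : dyadics, HasLaw (B r) (gaussianReal 0 (r : ℝ≥0)) P
  indep : HasIndepIncrements B P
  stationary : ∀ r h s : dyadics, (s : ℝ≥0) = r + h →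
    IdentDistrib (fun ω => B s ω - B r ω) (B h) P P

end Processes

section Paths

variable {Ω : Type*}

/-- `M_{k,n}`: the supremum of `|B(r) - B(k / 2 ^ n)|` over the dyadic
`r ∈ [k / 2 ^ n, (k + 2) / 2 ^ n]`, as an element of `[0, ∞]`. -/
noncomputable def localOsc (B : dyadics → Ω → ℝ) (k n : ℕ) (ω : Ω) : ℝ≥0∞ :=
  ⨆ r ∈ Set.Icc (dyad k n) (dyad (k + 2) n), ENNReal.ofReal |B r ω - B (dyad k n) ω|

/-- `M_n`: the supremum of `M_{k,n}` over `k ≤ (n + 1) 2 ^ n`. -/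
noncomputable def maxOsc (B : dyadics → Ω → ℝ) (n : ℕ) (ω : Ω) : ℝ≥0∞ :=
  ⨆ k ∈ Set.Iic ((n + 1) * 2 ^ n), localOsc B k n ω

/-- The event `N = {M_n > 1 / n infinitely often}`. -/
def oscEvent (B : dyadics → Ω → ℝ) : Set Ω :=
  {ω | ∃ᶠ n : ℕ in atTop, (n : ℝ≥0∞)⁻¹ < maxOsc B n ω}

/-- `D ∋ r ↓ t`, that is, `r → t` with `r ∈ D` and `r > t`. -/
def dyadicRight (t : ℝ≥0) : Filter dyadics := comap (fun r : dyadics => (r : ℝ≥0)) (𝓝[>] t)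

/-- `B̃(t, ω) = lim_{D ∋ r ↓ t} B(r, ω)` (an unspecified real number where there is no limit). -/
noncomputable def limitExtension (B : dyadics → Ω → ℝ) (t : ℝ≥0) (ω : Ω) : ℝ :=
  limUnder (dyadicRight t) (fun r => B r ω)

end Paths

/-!
Halving an interval splits the increment of the midpoint process over it into halves
`Δ / 2 ± X / √(2 ^ (n + 2))`. As the fresh variable enters with opposite signs, the increments over
dyadic intervals of length `2⁻ⁿ` stay uncorrelated with variance `2⁻ⁿ`, so that the process is
centred Gaussian with covariance `min r s`, which characterises Brownian motion on `D`.

For any Brownian motion on `D`, fourth moments and the Borel-Cantelli lemma bound almost surely all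
increments of level `m` up to time `m + 3` by `ρ ^ m`, for some `ρ < 1` and all large `m`. Chaining
through the levels `m ≥ n` gives `M_n = O(ρ ^ n)`, which is eventually below `1 / n`. Off the
exceptional event the paths are uniformly continuous on bounded sets, hence extend continuously by
density. The extension at finitely many times is an almost sure limit of centred Gaussian vectors
with converging covariances, so convergence of characteristic functions identifies its law.
-/

section Covariance

variable {Ω : Type*} [MeasurableSpace Ω] {P : Measure Ω} {S : Set (Ω → ℝ)} {Y Z : Ω → ℝ}

theorem memLp_of_mem_span {p : ℝ≥0∞} (hS : ∀ f ∈ S, MemLp f p P)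
    (hY : Y ∈ Submodule.span ℝ S) : MemLp Y p P := by
  induction hY using Submodule.span_induction with
  | mem f hf => exact hS f hf
  | zero => exact MemLp.zero
  | add f g _ _ hf hg => exact hf.add hg
  | smul a f _ hf => exact hf.const_smul a

theorem integral_eq_zero_of_mem_span (hS : ∀ f ∈ S, Integrable f P) (h0 : ∀ f ∈ S, P[f] = 0)
    (hY : Y ∈ Submodule.span ℝ S) : P[Y] = 0 := by
  have hint {f : Ω → ℝ} (hf : f ∈ Submodule.span ℝ S) : Integrable f P :=
    memLp_one_iff_integrable.1
      (memLp_of_mem_span (fun g hg ↦ memLp_one_iff_integrable.2 (hS g hg)) hf)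
  induction hY using Submodule.span_induction with
  | mem f hf => exact h0 f hf
  | zero => simp
  | add f g hf hg ihf ihg => rw [integral_add' (hint hf) (hint hg), ihf, ihg, add_zero]
  | smul a f _ ih => simp only [Pi.smul_apply, integral_smul, ih, smul_zero]

theorem covariance_eq_zero_of_mem_span [IsFiniteMeasure P] (hS : ∀ f ∈ S, MemLp f 2 P)
    (hZ : MemLp Z 2 P) (hc : ∀ f ∈ S, cov[f, Z; P] = 0) (hY : Y ∈ Submodule.span ℝ S) :
    cov[Y, Z; P] = 0 := by
  induction hY using Submodule.span_induction with
  | mem f hf => exact hc f hf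
  | zero => exact covariance_zero_left
  | add f g hf hg ihf ihg =>
    rw [covariance_add_left (memLp_of_mem_span hS hf) (memLp_of_mem_span hS hg) hZ, ihf, ihg,
      add_zero]
  | smul a f _ ih => rw [covariance_smul_left, ih, mul_zero]

theorem covariance_smul_add_smul [IsFiniteMeasure P] {U V U' V' : Ω → ℝ}
    (hU : MemLp U 2 P) (hV : MemLp V 2 P) (hU' : MemLp U' 2 P) (hV' : MemLp V' 2 P)
    (hUV' : cov[U, V'; P] = 0) (hU'V : cov[U', V; P] = 0)
    (a b a' b' : ℝ) :
    cov[a • U + b • V, a' • U' + b' • V'; P]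
      = a * a' * cov[U, U'; P] + b * b' * cov[V, V'; P] := by
  rw [covariance_add_left (hU.const_smul a) (hV.const_smul b)
      ((hU'.const_smul a').add (hV'.const_smul b')),
    covariance_add_right (hU.const_smul a) (hU'.const_smul a') (hV'.const_smul b'),
    covariance_add_right (hV.const_smul b) (hU'.const_smul a') (hV'.const_smul b')]
  simp only [covariance_smul_left, covariance_smul_right, hUV',
    covariance_comm V U', hU'V]
  ring

end Covariance

section GaussianProcess

variable {Ω : Type*} [MeasurableSpace Ω] {P : Measure Ω}

theorem hasLaw_gaussianReal_of_integral_eq_of_variance_eq {Y : Ω → ℝ} {m : ℝ} {v : ℝ≥0}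
    (hY : HasGaussianLaw Y P) (hm : P[Y] = m) (hv : Var[Y; P] = v) :
    HasLaw Y (gaussianReal m v) P where
  aemeasurable := hY.aemeasurable
  map_eq := by rw [hY.map_eq_gaussianReal, hm, hv, Real.toNNReal_coe]

theorem isGaussianProcess_of_iIndepFun {T : Type*} {X : T → Ω → ℝ} (hX : iIndepFun X P)
    (hlaw : ∀ t, HasGaussianLaw (X t) P) : IsGaussianProcess X P where
  hasGaussianLaw I :=
    (hX.precomp (g := ((↑) : I → T)) Subtype.val_injective).hasGaussianLaw fun t ↦ hlaw t

theorem isGaussianProcess_of_mem_span {S T : Type*} {X : S → Ω → ℝ} {Y : T → Ω → ℝ}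
    (hX : IsGaussianProcess X P) (hY : ∀ t, Y t ∈ Submodule.span ℝ (Set.range X)) :
    IsGaussianProcess Y P := by
  refine hX.of_isGaussianProcess fun t ↦ ?_
  obtain ⟨c, hc⟩ := Finsupp.mem_span_range_iff_exists_finsupp.1 (hY t)
  refine ⟨c.support, ∑ s : c.support, c s • ContinuousLinearMap.proj (R := ℝ) s, fun ω ↦ ?_⟩
  rw [← hc, Finsupp.sum, ← Finset.sum_coe_sort]
  simp [Finset.sum_apply]

variable {T : Type*} [LinearOrder T] {X : T → Ω → ℝ} {v : T → ℝ}

theorem hasIndepIncrements_of_covariance_eq_min (hX : IsGaussianProcess X P)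
    (hc : ∀ s t, cov[X s, X t; P] = v (min s t)) : HasIndepIncrements X P := by
  have := hX.isProbabilityMeasure
  have hL t : MemLp (X t) 2 P := (hX.hasGaussianLaw_eval t).memLp_two
  refine fun n t ht ↦ hX.hasGaussianLaw_increments.iIndepFun_of_covariance_eq_zero fun i j hij ↦ ?_
  wlog h : i < j generalizing i j
  · rw [covariance_comm]
    exact this j i hij.symm (hij.symm.lt_of_le (le_of_not_gt h))
  have hi : t i.castSucc ≤ t i.succ := ht (Fin.castSucc_le_succ i)
  have hmid : t i.succ ≤ t j.castSucc := ht (Fin.le_castSucc_iff.2 (Fin.strictMono_succ h))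
  have hj : t j.castSucc ≤ t j.succ := ht (Fin.castSucc_le_succ j)
  rw [covariance_fun_sub_fun_sub (hL _) (hL _) (hL _) (hL _), hc, hc, hc, hc,
    min_eq_left (hmid.trans hj), min_eq_left hmid, min_eq_left ((hi.trans hmid).trans hj),
    min_eq_left (hi.trans hmid)]
  ring

theorem variance_sub_of_covariance_eq_min [IsFiniteMeasure P] (hX : ∀ t, MemLp (X t) 2 P)
    (hc : ∀ s t, cov[X s, X t; P] = v (min s t)) {s t : T} (hst : s ≤ t) :
    Var[fun ω ↦ X t ω - X s ω; P] = v t - v s := by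
  rw [variance_fun_sub (hX t) (hX s), ← covariance_self (hX t).aemeasurable,
    ← covariance_self (hX s).aemeasurable, hc, hc, hc, min_self, min_self, min_eq_right hst]
  ring

end GaussianProcess

section FourthMoment

theorem lintegral_enorm_pow_gaussianReal (v : ℝ≥0) (p : ℕ) :
    ∫⁻ x, ‖x‖ₑ ^ p ∂gaussianReal 0 v
      = (NNReal.sqrt v : ℝ≥0∞) ^ p * ∫⁻ x, ‖x‖ₑ ^ p ∂gaussianReal 0 1 := by
  have hscale : gaussianReal 0 v = (gaussianReal 0 1).map ((NNReal.sqrt v : ℝ) * ·) := by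
    rw [gaussianReal_map_const_mul, mul_zero, mul_one]
    congr
    ext
    simp
  rw [hscale, lintegral_map (by fun_prop) (by fun_prop), ← lintegral_const_mul _ (by fun_prop)]
  simp only [enorm_mul, mul_pow, Real.enorm_of_nonneg NNReal.zero_le_coe, ENNReal.ofReal_coe_nnreal]

theorem lintegral_enorm_pow_gaussianReal_ne_top (m : ℝ) (v : ℝ≥0) (p : ℕ) :
    ∫⁻ x, ‖x‖ₑ ^ p ∂gaussianReal m v ≠ ∞ := by
  rcases eq_or_ne p 0 with rfl | hp
  · simp
  have h := (memLp_id_gaussianReal (μ := m) (v := v) p).integrable_norm_pow hp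
  simpa using h.2.ne

theorem measure_le_enorm_le_of_hasLaw_gaussianReal {Ω : Type*} [MeasurableSpace Ω] {P : Measure Ω}
    {Y : Ω → ℝ} {v ε : ℝ≥0} (hY : HasLaw Y (gaussianReal 0 v) P) (hε : ε ≠ 0) :
    P {ω | ε ≤ ‖Y ω‖ₑ} ≤ (v ^ 2 / ε ^ 4 : ℝ≥0) * ∫⁻ x, ‖x‖ₑ ^ 4 ∂gaussianReal 0 1 := by
  have hmoment : ∫⁻ ω, ‖Y ω‖ₑ ^ 4 ∂P = v ^ 2 * ∫⁻ x, ‖x‖ₑ ^ 4 ∂gaussianReal 0 1 := by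
    rw [← lintegral_map' (f := fun x : ℝ ↦ ‖x‖ₑ ^ 4) (by fun_prop) hY.aemeasurable, hY.map_eq,
      lintegral_enorm_pow_gaussianReal, pow_mul _ 2 2, ← ENNReal.coe_pow, NNReal.sq_sqrt]
  calc P {ω | ε ≤ ‖Y ω‖ₑ} = P {ω | (ε : ℝ≥0∞) ^ 4 ≤ ‖Y ω‖ₑ ^ 4} := by
        simp only [ENNReal.pow_le_pow_left_iff four_ne_zero]
    _ ≤ (∫⁻ ω, ‖Y ω‖ₑ ^ 4 ∂P) / (ε : ℝ≥0∞) ^ 4 :=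
      meas_ge_le_lintegral_div (hY.aemeasurable.enorm.pow_const 4) (by simpa using hε) (by simp)
    _ = (v ^ 2 / ε ^ 4 : ℝ≥0) * ∫⁻ x, ‖x‖ₑ ^ 4 ∂gaussianReal 0 1 := by
      rw [hmoment, ENNReal.coe_div (by positivity), ENNReal.mul_div_right_comm]
      push_cast
      rfl

end FourthMoment

section LimitLaw

variable {Ω : Type*} [MeasurableSpace Ω] {P : Measure Ω}

theorem tendsto_charFunDual_map_of_ae_tendsto {E κ : Type*} [NormedAddCommGroup E] [NormedSpace ℝ E]
    [MeasurableSpace E] [BorelSpace E] [IsFiniteMeasure P] {l : Filter κ} [l.IsCountablyGenerated]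
    {Y : κ → Ω → E} {W : Ω → E} (hY : ∀ n, AEMeasurable (Y n) P) (hW : AEMeasurable W P)
    (hlim : ∀ᵐ ω ∂P, Tendsto (Y · ω) l (𝓝 (W ω))) (L : StrongDual ℝ E) :
    Tendsto (fun n ↦ charFunDual (P.map (Y n)) L) l (𝓝 (charFunDual (P.map W) L)) := by
  have hcont : Continuous fun x ↦ Complex.exp (L x * Complex.I) := by fun_prop
  have hmap {Z : Ω → E} (hZ : AEMeasurable Z P) :
      charFunDual (P.map Z) L = ∫ ω, Complex.exp (L (Z ω) * Complex.I) ∂P := by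
    rw [charFunDual_apply, integral_map hZ (by fun_prop)]
  simp only [hmap hW, fun n ↦ hmap (hY n)]
  refine tendsto_integral_filter_of_dominated_convergence (fun _ ↦ 1)
    (.of_forall fun n ↦ (hcont.measurable.comp_aemeasurable (hY n)).aestronglyMeasurable)
    (.of_forall fun n ↦ .of_forall fun ω ↦ (Complex.norm_exp_ofReal_mul_I _).le)
    (integrable_const 1) ?_
  filter_upwards [hlim] with ω hω using (hcont.tendsto _).comp hω

theorem hasLaw_of_ae_tendsto_of_hasGaussianLaw {E κ : Type*} [NormedAddCommGroup E]
    [NormedSpace ℝ E] [MeasurableSpace E] [BorelSpace E] [SecondCountableTopology E]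
    [CompleteSpace E] {l : Filter κ} [l.IsCountablyGenerated] [l.NeBot] {ν : Measure E}
    [IsGaussian ν] {Y : κ → Ω → E} {W : Ω → E} (hY : ∀ n, HasGaussianLaw (Y n) P)
    (hmean : Tendsto (fun n ↦ P[Y n]) l (𝓝 ν[id]))
    (hvar : ∀ L : StrongDual ℝ E, Tendsto (fun n ↦ Var[L ∘ Y n; P]) l (𝓝 Var[L; ν]))
    (hlim : ∀ᵐ ω ∂P, Tendsto (Y · ω) l (𝓝 (W ω))) : HasLaw W ν P := by
  obtain ⟨n₀⟩ := l.nonempty_of_neBot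
  have := (hY n₀).isProbabilityMeasure
  have hW : AEMeasurable W P :=
    aemeasurable_of_tendsto_metrizable_ae l (fun n ↦ (hY n).aemeasurable) hlim
  have := Measure.isProbabilityMeasure_map hW
  refine ⟨hW, Measure.ext_of_charFunDual (funext fun L ↦ ?_)⟩
  refine tendsto_nhds_unique
    (tendsto_charFunDual_map_of_ae_tendsto (fun n ↦ (hY n).aemeasurable) hW hlim L) ?_
  have hmeanL : Tendsto (fun n ↦ ∫ ω, (L ∘ Y n) ω ∂P) l (𝓝 (∫ x, L x ∂ν)) := by
    simp only [Function.comp_apply, fun n ↦ L.integral_comp_comm (hY n).integrable,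
      L.integral_comp_comm (φ := fun x ↦ x) (μ := ν) IsGaussian.integrable_id]
    exact (L.continuous.tendsto _).comp hmean
  simp only [(hY _).charFunDual_map_eq, IsGaussian.charFunDual_eq, integral_complex_ofReal]
  have hcont : Continuous fun p : ℝ × ℝ ↦ Complex.exp (p.1 * Complex.I - p.2 / 2) := by fun_prop
  exact (hcont.tendsto _).comp (hmeanL.prodMk_nhds (hvar L))

theorem variance_dual_comp_pi {ι : Type*} [Fintype ι] [DecidableEq ι] [IsFiniteMeasure P]
    {Z : ι → Ω → ℝ} (hZ : ∀ i, MemLp (Z i) 2 P) (L : StrongDual ℝ (ι → ℝ)) :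
    Var[fun ω ↦ L (Z · ω); P]
      = ∑ i, ∑ j, L (Pi.single i 1) * L (Pi.single j 1) * cov[Z i, Z j; P] := by
  have hL (ω : Ω) : L (Z · ω) = ∑ i, L (Pi.single i 1) * Z i ω := by
    rw [pi_eq_sum_univ' (Z · ω)]
    simp [mul_comm]
  simp only [hL]
  rw [variance_fun_sum fun i ↦ (hZ i).const_mul _]
  simp_rw [covariance_const_mul_left, covariance_const_mul_right, mul_assoc]

theorem hasLaw_pi_of_ae_tendsto_of_hasGaussianLaw {ι κ : Type*} [Finite ι] {l : Filter κ}
    [l.IsCountablyGenerated] [l.NeBot] {ν : Measure (ι → ℝ)} [IsGaussian ν]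
    {Y : κ → ι → Ω → ℝ} {W : ι → Ω → ℝ} (hY : ∀ n, HasGaussianLaw (fun ω i ↦ Y n i ω) P)
    (hmean : ∀ i, Tendsto (fun n ↦ P[Y n i]) l (𝓝 (∫ x, x i ∂ν)))
    (hcov : ∀ i j, Tendsto (fun n ↦ cov[Y n i, Y n j; P]) l
      (𝓝 cov[fun x ↦ x i, fun x ↦ x j; ν]))
    (hlim : ∀ i, ∀ᵐ ω ∂P, Tendsto (Y · i ω) l (𝓝 (W i ω))) :
    HasLaw (fun ω i ↦ W i ω) ν P := by
  classical
  have := Fintype.ofFinite ι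
  obtain ⟨n₀⟩ := l.nonempty_of_neBot
  have := (hY n₀).isProbabilityMeasure
  have hL n i : MemLp (Y n i) 2 P := ((hY n).eval i).memLp_two
  have hid : HasGaussianLaw (fun x i ↦ x i) ν := IsGaussian.hasGaussianLaw_id
  refine hasLaw_of_ae_tendsto_of_hasGaussianLaw (l := l) (Y := fun n ω i ↦ Y n i ω) hY ?_
    (fun L ↦ ?_) ?_
  · refine tendsto_pi_nhds.2 fun i ↦ ?_
    have hν : ν[id] i = ∫ x, x i ∂ν := eval_integral (fun i ↦ (hid.eval i).integrable) i
    have hYi n : (∫ ω, (Y n · ω) ∂P) i = P[Y n i] :=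
      eval_integral (fun i ↦ ((hY n).eval i).integrable) i
    simpa only [hν, hYi] using hmean i
  · have hν : Var[L; ν] = _ := variance_dual_comp_pi (fun i ↦ (hid.eval i).memLp_two) L
    have hYL n : Var[L ∘ fun ω i ↦ Y n i ω; P] = _ := variance_dual_comp_pi (hL n) L
    simp only [hν, hYL]
    exact tendsto_finsetSum _ fun i _ ↦ tendsto_finsetSum _ fun j _ ↦ (hcov i j).const_mul _
  · filter_upwards [ae_all_iff.2 hlim] with ω hω using tendsto_pi_nhds.2 hω

end LimitLaw

section GeometricDecay

theorem eventually_mul_pow_le_inv {ρ : ℝ≥0} (hρ : ρ < 1) (K : ℝ≥0) :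
    ∀ᶠ n : ℕ in atTop, K * ρ ^ n ≤ (n : ℝ≥0)⁻¹ := by
  have hlim : Tendsto (fun n : ℕ ↦ K * (n * ρ ^ n)) atTop (𝓝 0) := by
    have h : Tendsto (fun n : ℕ ↦ n * ρ ^ n) atTop (𝓝 0) :=
      NNReal.tendsto_coe.1 <| by
        simpa using tendsto_self_mul_const_pow_of_lt_one ρ.coe_nonneg hρ
    simpa using h.const_mul K
  filter_upwards [hlim.eventually_le_const one_pos, eventually_gt_atTop 0] with n hn hn0
  rwa [← one_div, le_div_iff₀ (by positivity), mul_assoc, mul_comm (ρ ^ n)]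

theorem summable_add_const_mul_geometric {q : ℝ≥0} (hq : q < 1) (c : ℝ≥0) :
    Summable fun m : ℕ ↦ (m + c) * q ^ m := by
  have h := summable_pow_mul_geometric_of_norm_lt_one (r := (q : ℝ)) 1 (by simpa using hq)
  simp only [add_mul]
  refine .add ?_ ((NNReal.summable_geometric hq).mul_left c)
  rw [← NNReal.summable_coe]
  simpa using h

end GeometricDecay

section DenseLimit

theorem exists_tendsto_of_uniformContinuousOn_of_dense {α β : Type*} [UniformSpace α]
    [UniformSpace β] [CompleteSpace β] {D : Set α} (hD : Dense D) {f : D → β}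
    {u : Set α} {a : α} (hu : u ∈ 𝓝 a) (hf : UniformContinuousOn f ((↑) ⁻¹' u)) :
    ∃ c, Tendsto f (comap (↑) (𝓝 a)) (𝓝 c) := by
  have hcauchy : Cauchy (comap ((↑) : D → α) (𝓝 a)) :=
    cauchy_nhds.comap' le_rfl (hD.comap_val_nhds_neBot a)
  exact CompleteSpace.complete (hcauchy.map_of_le hf (le_principal_iff.2 (preimage_mem_comap hu)))

end DenseLimit

section Dyadic

theorem coe_dyad (k n : ℕ) : (dyad k n : ℝ≥0) = k / 2 ^ n := rfl

theorem dyad_eq_iff {k n l m : ℕ} : dyad k n = dyad l m ↔ k * 2 ^ m = l * 2 ^ n := by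
  rw [Subtype.ext_iff, coe_dyad, coe_dyad, div_eq_div_iff (by positivity) (by positivity)]
  norm_cast

theorem dyad_le_iff {k n l m : ℕ} : dyad k n ≤ dyad l m ↔ k * 2 ^ m ≤ l * 2 ^ n := by
  rw [← Subtype.coe_le_coe, coe_dyad, coe_dyad, div_le_div_iff₀ (by positivity) (by positivity)]
  norm_cast

theorem dyad_left_injective (n : ℕ) : Function.Injective (dyad · n) := fun _ _ h ↦
  Nat.eq_of_mul_eq_mul_right (by positivity) (dyad_eq_iff.1 h)

theorem monotone_dyad (n : ℕ) : Monotone (dyad · n) := fun _ _ h ↦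
  dyad_le_iff.2 (Nat.mul_le_mul_right _ h)

theorem dyad_mul_two_pow (k n i : ℕ) : dyad (k * 2 ^ i) (n + i) = dyad k n := by
  rw [dyad_eq_iff]
  ring

theorem dyad_two_mul (k n : ℕ) : dyad (2 * k) (n + 1) = dyad k n := by
  rw [dyad_eq_iff]
  ring

theorem exists_eq_dyad (r : dyadics) : ∃ k n, r = dyad k n :=
  let ⟨k, n, h⟩ := r.2
  ⟨k, n, Subtype.ext h⟩

theorem exists_eq_dyad_of_same_level (r s : dyadics) : ∃ k l n, r = dyad k n ∧ s = dyad l n := by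
  obtain ⟨k, n, rfl⟩ := exists_eq_dyad r
  obtain ⟨l, m, rfl⟩ := exists_eq_dyad s
  exact ⟨k * 2 ^ m, l * 2 ^ n, n + m, (dyad_mul_two_pow k n m).symm,
    by rw [add_comm, dyad_mul_two_pow]⟩

theorem dyad_floor_le (t : ℝ≥0) (n : ℕ) : (dyad ⌊t * 2 ^ n⌋₊ n : ℝ≥0) ≤ t :=
  (div_le_iff₀ (by positivity)).2 (Nat.floor_le zero_le)

theorem lt_dyad_floor_add_one (t : ℝ≥0) (n : ℕ) : t < dyad (⌊t * 2 ^ n⌋₊ + 1) n := by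
  rw [coe_dyad, lt_div_iff₀ (by positivity)]
  exact_mod_cast Nat.lt_floor_add_one (t * 2 ^ n)

theorem coe_dyad_add (k l n : ℕ) : (dyad (k + l) n : ℝ≥0) = dyad k n + dyad l n := by
  simp only [coe_dyad, Nat.cast_add, add_div]

theorem dense_dyadics : Dense dyadics := by
  refine dense_of_exists_between fun s t hst ↦ ?_
  obtain ⟨n, hn⟩ := exists_pow_lt_of_lt_one (tsub_pos_of_lt hst) one_half_lt_one
  refine ⟨_, (dyad (⌊s * 2 ^ n⌋₊ + 1) n).2, lt_dyad_floor_add_one s n, ?_⟩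
  calc (dyad (⌊s * 2 ^ n⌋₊ + 1) n : ℝ≥0) = dyad ⌊s * 2 ^ n⌋₊ n + (1 / 2) ^ n := by
        rw [coe_dyad_add, coe_dyad 1, Nat.cast_one, one_div_pow]
    _ < s + (t - s) := add_lt_add_of_le_of_lt (dyad_floor_le s n) hn
    _ = t := add_tsub_cancel_of_le hst.le

/-- The least dyadic number is `0`, the time at which a process on `D` is started; with this
instance `IsDyadicBrownian.initial` is the initial condition at `⊥` that Mathlib expects of a
process with independent increments. -/
noncomputable instance : OrderBot dyadics where
  bot := dyad 0 0
  bot_le r := Subtype.coe_le_coe.1 (by simp [coe_dyad])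

end Dyadic

section LevelIncrement

variable {Ω : Type*}

theorem levelValue_succ_odd (X : dyadics → Ω → ℝ) (n a : ℕ) :
    levelValue X (n + 1) (2 * a + 1) = (2⁻¹ : ℝ) • (levelValue X n a + levelValue X n (a + 1))
      + (√(2 ^ (n + 2)))⁻¹ • X (dyad (2 * a + 1) (n + 1)) := by
  ext ω
  simp only [← midpointProcess_dyad, midpointProcess_mid, Pi.add_apply, Pi.smul_apply, smul_eq_mul]
  ring

/-- The increment over `[j / 2 ^ n, (j + 1) / 2 ^ n]` of the process built from `X`. At a fixed
level these increments turn out to be uncorrelated, which determines all covariances. -/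
noncomputable def levelIncrement (X : dyadics → Ω → ℝ) (n j : ℕ) : Ω → ℝ :=
  levelValue X n (j + 1) - levelValue X n j

theorem levelIncrement_zero (X : dyadics → Ω → ℝ) (j : ℕ) :
    levelIncrement X 0 j = X (dyad (j + 1) 0) := by
  ext ω
  simp [levelIncrement, levelValue, Finset.sum_range_succ]

-- The midpoint term enters the two halves of an interval with opposite signs.
theorem levelIncrement_succ (X : dyadics → Ω → ℝ) (n j : ℕ) :
    levelIncrement X (n + 1) j = (2⁻¹ : ℝ) • levelIncrement X n (j / 2)
      + ((-1) ^ j * (√(2 ^ (n + 2)))⁻¹ : ℝ) • X (dyad (2 * (j / 2) + 1) (n + 1)) := by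
  obtain ⟨a, rfl | rfl⟩ := Nat.even_or_odd' j
  · rw [levelIncrement, levelIncrement, levelValue_double, levelValue_succ_odd,
      Nat.mul_div_cancel_left a two_pos, (even_two_mul a).neg_one_pow]
    module
  · rw [levelIncrement, levelIncrement, show 2 * a + 1 + 1 = 2 * (a + 1) by ring,
      levelValue_double, levelValue_succ_odd, show (2 * a + 1) / 2 = a by omega,
      (odd_two_mul_add_one a).neg_one_pow]
    module

theorem levelIncrement_mem_span (X : dyadics → Ω → ℝ) (n j : ℕ) :
    levelIncrement X n j ∈ Submodule.span ℝ (X '' Set.range (dyad · n)) := by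
  have hmem n k : X (dyad k n) ∈ Submodule.span ℝ (X '' Set.range (dyad · n)) :=
    Submodule.subset_span ⟨_, ⟨k, rfl⟩, rfl⟩
  induction n generalizing j with
  | zero => rw [levelIncrement_zero]; exact hmem 0 (j + 1)
  | succ n ih =>
    have hle : X '' Set.range (dyad · n) ⊆ X '' Set.range (dyad · (n + 1)) :=
      Set.image_mono (Set.range_subset_iff.2 fun k ↦ ⟨2 * k, dyad_two_mul k n⟩)
    rw [levelIncrement_succ]
    exact add_mem (Submodule.smul_mem _ _ (Submodule.span_mono hle (ih _)))
      (Submodule.smul_mem _ _ (hmem _ _))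

theorem levelValue_eq_sum_levelIncrement (X : dyadics → Ω → ℝ) (n k : ℕ) :
    levelValue X n k = ∑ j ∈ Finset.range k, levelIncrement X n j := by
  have h0 : levelValue X n 0 = 0 := by
    rw [← midpointProcess_dyad, dyad_eq_iff.2 (by simp : 0 * 2 ^ 0 = 0 * 2 ^ n)]
    ext ω
    simp [midpointProcess_nat]
  simp only [levelIncrement, Finset.sum_range_sub, h0, sub_zero]

theorem midpointProcess_mem_span (X : dyadics → Ω → ℝ) (r : dyadics) :
    midpointProcess X r ∈ Submodule.span ℝ (Set.range X) := by
  obtain ⟨k, n, rfl⟩ := exists_eq_dyad r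
  rw [midpointProcess_dyad, levelValue_eq_sum_levelIncrement]
  exact sum_mem fun j _ ↦
    Submodule.span_mono (Set.image_subset_range _ _) (levelIncrement_mem_span X n j)

end LevelIncrement

section MidpointCovariance

variable {Ω : Type*} [MeasurableSpace Ω] {P : Measure Ω} [IsFiniteMeasure P]
  {X : dyadics → Ω → ℝ}

theorem covariance_levelIncrement_of_odd (hX : ∀ r, MemLp (X r) 2 P)
    (hc : Pairwise fun r s ↦ cov[X r, X s; P] = 0) (n i a : ℕ) :
    cov[levelIncrement X n i, X (dyad (2 * a + 1) (n + 1)); P] = 0 := by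
  refine covariance_eq_zero_of_mem_span (Set.forall_mem_image.2 fun r _ ↦ hX r) (hX _) ?_
    (levelIncrement_mem_span X n i)
  rintro _ ⟨_, ⟨k, rfl⟩, rfl⟩
  refine hc fun h ↦ ?_
  have : 2 * k = 2 * a + 1 := dyad_left_injective (n + 1) ((dyad_two_mul k n).trans h)
  omega

theorem covariance_levelIncrement (hX : ∀ r, MemLp (X r) 2 P) (hv : ∀ r, Var[X r; P] = 1)
    (hc : Pairwise fun r s ↦ cov[X r, X s; P] = 0) (n i j : ℕ) :
    cov[levelIncrement X n i, levelIncrement X n j; P] = if i = j then (2 ^ n)⁻¹ else 0 := by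
  have hcov (n k l : ℕ) : cov[X (dyad k n), X (dyad l n); P] = if k = l then 1 else 0 := by
    split_ifs with hkl
    · rw [hkl, covariance_self (hX _).aemeasurable, hv]
    · exact hc ((dyad_left_injective n).ne hkl)
  induction n generalizing i j with
  | zero => simp [levelIncrement_zero, hcov]
  | succ n ih =>
    have hL i : MemLp (levelIncrement X n i) 2 P :=
      memLp_of_mem_span (Set.forall_mem_image.2 fun r _ ↦ hX r) (levelIncrement_mem_span X n i)
    have hsqrt : (√(2 ^ (n + 2) : ℝ))⁻¹ * (√(2 ^ (n + 2)))⁻¹ = (2 ^ (n + 2))⁻¹ := by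
      rw [← mul_inv, Real.mul_self_sqrt (by positivity)]
    rw [levelIncrement_succ, levelIncrement_succ, covariance_smul_add_smul (hL _) (hX _) (hL _)
      (hX _) (covariance_levelIncrement_of_odd hX hc ..)
      (covariance_levelIncrement_of_odd hX hc ..), ih, hcov]
    rcases eq_or_ne (i / 2) (j / 2) with hij | hij
    · have hsign : ((-1) ^ i * (-1) ^ j : ℝ) = if i = j then 1 else -1 := by
        rw [← pow_add]
        split_ifs with h
        · exact Even.neg_one_pow (by grind)
        · exact Odd.neg_one_pow (by grind)
      rw [if_pos hij, if_pos (by rw [hij]), mul_mul_mul_comm ((-1) ^ i), hsign, hsqrt]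
      split_ifs <;> field_simp <;> ring
    · rw [if_neg hij, if_neg (by omega), if_neg (by grind)]
      ring

theorem covariance_levelValue (hX : ∀ r, MemLp (X r) 2 P) (hv : ∀ r, Var[X r; P] = 1)
    (hc : Pairwise fun r s ↦ cov[X r, X s; P] = 0) (n k l : ℕ) :
    cov[levelValue X n k, levelValue X n l; P] = (min k l : ℕ) / 2 ^ n := by
  have hL i : MemLp (levelIncrement X n i) 2 P :=
    memLp_of_mem_span (Set.forall_mem_image.2 fun r _ ↦ hX r) (levelIncrement_mem_span X n i)
  rw [levelValue_eq_sum_levelIncrement, levelValue_eq_sum_levelIncrement,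
    covariance_sum_sum' (fun i _ ↦ hL i) (fun j _ ↦ hL j)]
  simp only [covariance_levelIncrement hX hv hc, Finset.sum_ite_eq, Finset.mem_range]
  rw [← Finset.sum_filter, Finset.sum_const, nsmul_eq_mul, div_eq_mul_inv]
  congr 2
  rw [← Finset.card_range (min k l)]
  congr 1
  ext
  simp

theorem covariance_midpointProcess (hX : ∀ r, MemLp (X r) 2 P) (hv : ∀ r, Var[X r; P] = 1)
    (hc : Pairwise fun r s ↦ cov[X r, X s; P] = 0) (r s : dyadics) :
    cov[midpointProcess X r, midpointProcess X s; P] = ((min r s : dyadics) : ℝ≥0) := by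
  obtain ⟨k, l, n, rfl, rfl⟩ := exists_eq_dyad_of_same_level r s
  rw [midpointProcess_dyad, midpointProcess_dyad, covariance_levelValue hX hv hc,
    ← (monotone_dyad n).map_min, coe_dyad]
  push_cast
  rfl

end MidpointCovariance

section DyadicBrownian

variable {Ω : Type*} [MeasurableSpace Ω] {P : Measure Ω} {B : dyadics → Ω → ℝ}

theorem isDyadicBrownian_of_covariance_eq_min (hB : IsGaussianProcess B P)
    (h0 : ∀ r, P[B r] = 0) (hc : ∀ r s, cov[B r, B s; P] = ((min r s : dyadics) : ℝ≥0)) :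
    IsDyadicBrownian B P := by
  have := hB.isProbabilityMeasure
  have hL r : MemLp (B r) 2 P := (hB.hasGaussianLaw_eval r).memLp_two
  have hint r : Integrable (B r) P := (hL r).integrable one_le_two
  have hmarginal (r : dyadics) : HasLaw (B r) (gaussianReal 0 (r : ℝ≥0)) P :=
    hasLaw_gaussianReal_of_integral_eq_of_variance_eq (hB.hasGaussianLaw_eval r) (h0 r)
      (by rw [← covariance_self (hL r).aemeasurable, hc, min_self])
  refine ⟨?_, hmarginal, hasIndepIncrements_of_covariance_eq_min (v := fun r ↦ (r : ℝ≥0)) hB hc,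
    fun r h s hs ↦ ?_⟩
  · have hdirac := hmarginal (dyad 0 0)
    rw [coe_dyad, Nat.cast_zero, zero_div, gaussianReal_zero_var] at hdirac
    exact hdirac.ae_eq_of_dirac
  · have hrs : r ≤ s := Subtype.coe_le_coe.1 (hs ▸ le_self_add)
    have hsub : HasLaw (fun ω ↦ B s ω - B r ω) (gaussianReal 0 (h : ℝ≥0)) P :=
      hasLaw_gaussianReal_of_integral_eq_of_variance_eq hB.hasGaussianLaw_fun_sub
        (by rw [integral_sub (hint s) (hint r), h0, h0, sub_zero])
        (by rw [variance_sub_of_covariance_eq_min (v := fun r : dyadics ↦ (r : ℝ≥0)) hL hc hrs, hs,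
          NNReal.coe_add, add_sub_cancel_left])
    exact ⟨hsub.aemeasurable, (hmarginal h).aemeasurable,
      hsub.map_eq.trans (hmarginal h).map_eq.symm⟩

theorem isDyadicBrownian_midpointProcess {X : dyadics → Ω → ℝ} (hX : iIndepFun X P)
    (hlaw : ∀ r, HasLaw (X r) (gaussianReal 0 1) P) : IsDyadicBrownian (midpointProcess X) P := by
  have hgauss : IsGaussianProcess X P :=
    isGaussianProcess_of_iIndepFun hX fun r ↦ (hlaw r).hasGaussianLaw
  have := hgauss.isProbabilityMeasure
  have hL r : MemLp (X r) 2 P := (hlaw r).hasGaussianLaw.memLp_two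
  have h0 r : P[X r] = 0 := by rw [(hlaw r).integral_eq, integral_id_gaussianReal]
  have hv r : Var[X r; P] = 1 := by
    rw [(hlaw r).variance_eq, variance_id_gaussianReal, NNReal.coe_one]
  have hc : Pairwise fun r s ↦ cov[X r, X s; P] = 0 := fun r s hrs ↦
    (hX.indepFun hrs).covariance_eq_zero (hL r) (hL s)
  exact isDyadicBrownian_of_covariance_eq_min
    (isGaussianProcess_of_mem_span hgauss (midpointProcess_mem_span X))
    (fun r ↦ integral_eq_zero_of_mem_span
      (Set.forall_mem_range.2 fun s ↦ (hL s).integrable one_le_two) (Set.forall_mem_range.2 h0)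
      (midpointProcess_mem_span X r))
    (covariance_midpointProcess hL hv hc)

namespace IsDyadicBrownian

theorem isGaussianProcess (hB : IsDyadicBrownian B P) : IsGaussianProcess B P :=
  hB.indep.isGaussianProcess (fun r ↦ (hB.marginal r).hasGaussianLaw) hB.initial

theorem integral_eq_zero (hB : IsDyadicBrownian B P) (r : dyadics) : P[B r] = 0 := by
  rw [(hB.marginal r).integral_eq, integral_id_gaussianReal]

theorem covariance_eq_min (hB : IsDyadicBrownian B P) (r s : dyadics) :
    cov[B r, B s; P] = ((min r s : dyadics) : ℝ≥0) := by
  have := hB.isGaussianProcess.isProbabilityMeasure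
  have hL r : MemLp (B r) 2 P := (hB.marginal r).hasGaussianLaw.memLp_two
  wlog hrs : r ≤ s generalizing r s
  · rw [covariance_comm, this s r (le_of_not_ge hrs), min_comm]
  have hindep : B r ⟂ᵢ[P] B s - B r := hB.indep.indepFun_eval_sub bot_le hrs hB.initial
  calc cov[B r, B s; P] = cov[B r, (B s - B r) + B r; P] := by rw [sub_add_cancel]
    _ = Var[B r; P] := by
      rw [covariance_add_right (hL r) ((hL s).sub (hL r)) (hL r),
        hindep.covariance_eq_zero (hL r) ((hL s).sub (hL r)), zero_add,
        covariance_self (hL r).aemeasurable]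
    _ = ((min r s : dyadics) : ℝ≥0) := by
      rw [(hB.marginal r).variance_eq, variance_id_gaussianReal, min_eq_left hrs]

theorem hasLaw_increment (hB : IsDyadicBrownian B P) (j n : ℕ) :
    HasLaw (fun ω ↦ B (dyad (j + 1) n) ω - B (dyad j n) ω) (gaussianReal 0 (2⁻¹ ^ n)) P := by
  have h := hB.stationary (dyad j n) (dyad 1 n) (dyad (j + 1) n) (coe_dyad_add j 1 n)
  refine ⟨h.aemeasurable_fst, ?_⟩
  rw [h.map_eq, (hB.marginal _).map_eq, coe_dyad, Nat.cast_one, one_div, inv_pow]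

end IsDyadicBrownian

end DyadicBrownian

section Chaining

theorem edist_dyad_le_of_increments_le {E : Type*} [PseudoEMetricSpace E] {b : dyadics → E}
    {δ : ℕ → ℝ≥0∞} {n k : ℕ}
    (h : ∀ i j, k * 2 ^ i ≤ j → j < (k + 2) * 2 ^ i →
      edist (b (dyad (j + 1) (n + i))) (b (dyad j (n + i))) ≤ δ i)
    {i j : ℕ} (hkj : k * 2 ^ i ≤ j) (hjk : j ≤ (k + 2) * 2 ^ i) :
    edist (b (dyad j (n + i))) (b (dyad k n)) ≤ δ 0 + ∑ m ∈ Finset.range (i + 1), δ m := by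
  induction i generalizing j with
  | zero =>
    have h0 : edist (b (dyad (k + 1) n)) (b (dyad k n)) ≤ δ 0 := h 0 k (by omega) (by omega)
    have h1 : edist (b (dyad (k + 2) n)) (b (dyad (k + 1) n)) ≤ δ 0 :=
      h 0 (k + 1) (by omega) (by omega)
    rw [Finset.sum_range_one]
    obtain rfl | rfl | rfl : j = k ∨ j = k + 1 ∨ j = k + 2 := by omega
    · simp
    · exact h0.trans le_self_add
    · exact (edist_triangle _ _ _).trans (add_le_add h1 h0)
  | succ i ih =>
    rw [Finset.sum_range_succ, ← add_assoc, ← add_assoc]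
    rw [pow_succ, ← mul_assoc] at hkj hjk
    obtain ⟨a, rfl | rfl⟩ := Nat.even_or_odd' j
    · rw [dyad_two_mul]
      exact (ih (by omega) (by omega)).trans le_self_add
    · have hmid := h (i + 1) (2 * a) (by rw [pow_succ, ← mul_assoc]; omega)
        (by rw [pow_succ, ← mul_assoc]; omega)
      rw [← add_assoc, dyad_two_mul] at hmid
      rw [add_comm _ (δ (i + 1))]
      exact (edist_triangle _ _ _).trans (add_le_add hmid (ih (by omega) (by omega)))

theorem edist_le_tsum_of_increments_le {E : Type*} [PseudoEMetricSpace E] {b : dyadics → E}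
    {δ : ℕ → ℝ≥0∞} {n k : ℕ}
    (h : ∀ i j, k * 2 ^ i ≤ j → j < (k + 2) * 2 ^ i →
      edist (b (dyad (j + 1) (n + i))) (b (dyad j (n + i))) ≤ δ i)
    {r : dyadics} (hr : r ∈ Set.Icc (dyad k n) (dyad (k + 2) n)) :
    edist (b r) (b (dyad k n)) ≤ δ 0 + ∑' i, δ i := by
  obtain ⟨l, m, rfl⟩ := exists_eq_dyad r
  rw [← dyad_mul_two_pow l m n, add_comm m n]
  refine (edist_dyad_le_of_increments_le h (dyad_le_iff.1 hr.1) (dyad_le_iff.1 hr.2)).trans ?_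
  gcongr
  exact ENNReal.sum_le_tsum _

end Chaining

section Oscillation

variable {Ω : Type*} {B : dyadics → Ω → ℝ} {ω : Ω}

theorem localOsc_eq_iSup_edist (B : dyadics → Ω → ℝ) (k n : ℕ) (ω : Ω) :
    localOsc B k n ω
      = ⨆ r ∈ Set.Icc (dyad k n) (dyad (k + 2) n), edist (B r ω) (B (dyad k n) ω) := by
  simp only [localOsc, edist_dist, Real.dist_eq]

theorem maxOsc_le_of_increments_le {δ : ℕ → ℝ≥0∞} {n : ℕ}
    (h : ∀ m ≥ n, ∀ j < (m + 3) * 2 ^ m,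
      edist (B (dyad (j + 1) m) ω) (B (dyad j m) ω) ≤ δ m) :
    maxOsc B n ω ≤ δ n + ∑' i, δ (n + i) := by
  refine iSup₂_le fun k hk ↦ ?_
  rw [localOsc_eq_iSup_edist]
  refine iSup₂_le fun r hr ↦ edist_le_tsum_of_increments_le (b := (B · ω)) (δ := fun i ↦ δ (n + i))
    (fun i j _ hj ↦ h (n + i) le_self_add j (hj.trans_le ?_)) hr
  calc (k + 2) * 2 ^ i ≤ ((n + 1) * 2 ^ n + 2 * 2 ^ n) * 2 ^ i := by
        gcongr
        · exact hk
        · exact Nat.le_mul_of_pos_right 2 (by positivity)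
    _ = (n + 3) * 2 ^ (n + i) := by ring
    _ ≤ (n + i + 3) * 2 ^ (n + i) := by gcongr; exact le_self_add

theorem notMem_oscEvent_of_eventually_increments_le {ρ : ℝ≥0} (hρ : ρ < 1)
    (h : ∀ᶠ m : ℕ in atTop, ∀ j < (m + 3) * 2 ^ m,
      edist (B (dyad (j + 1) m) ω) (B (dyad j m) ω) ≤ ρ ^ m) :
    ω ∉ oscEvent B := by
  have hK : 1 + ∑' i : ℕ, (ρ : ℝ≥0∞) ^ i = (1 + (1 - ρ)⁻¹ : ℝ≥0) := by
    rw [ENNReal.tsum_geometric, ENNReal.coe_add, ENNReal.coe_inv (tsub_pos_of_lt hρ).ne']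
    simp
  obtain ⟨n₀, hn₀⟩ := eventually_atTop.1 h
  refine fun hω ↦ hω ?_
  filter_upwards [eventually_mul_pow_le_inv hρ (1 + (1 - ρ)⁻¹), eventually_ge_atTop n₀,
    eventually_gt_atTop 0] with n hn hn₀n hn0
  rw [not_lt]
  calc maxOsc B n ω ≤ ρ ^ n + ∑' i, (ρ : ℝ≥0∞) ^ (n + i) :=
        maxOsc_le_of_increments_le (δ := fun m ↦ ρ ^ m) fun m hm ↦ hn₀ m (hn₀n.trans hm)
    _ = (1 + ∑' i : ℕ, (ρ : ℝ≥0∞) ^ i) * ρ ^ n := by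
      simp only [pow_add, ENNReal.tsum_mul_left]
      ring
    _ = ((1 + (1 - ρ)⁻¹) * ρ ^ n : ℝ≥0) := by rw [hK]; push_cast; rfl
    _ ≤ ((n : ℝ≥0)⁻¹ : ℝ≥0) := by exact_mod_cast hn
    _ = (n : ℝ≥0∞)⁻¹ := by rw [ENNReal.coe_inv (by positivity), ENNReal.coe_natCast]

end Oscillation

section BorelCantelli

variable {Ω : Type*} [MeasurableSpace Ω] {P : Measure Ω} {B : dyadics → Ω → ℝ}

theorem IsDyadicBrownian.ae_eventually_increments_le (hB : IsDyadicBrownian B P) {ρ : ℝ≥0}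
    (hρ : 1 < 2 * ρ ^ 4) :
    ∀ᵐ ω ∂P, ∀ᶠ m : ℕ in atTop, ∀ j < (m + 3) * 2 ^ m,
      edist (B (dyad (j + 1) m) ω) (B (dyad j m) ω) ≤ ρ ^ m := by
  have hρ0 : ρ ≠ 0 := by rintro rfl; simp at hρ
  set M : ℝ≥0∞ := ∫⁻ x, ‖x‖ₑ ^ 4 ∂gaussianReal 0 1
  let large (m j : ℕ) : Set Ω := {ω | (ρ : ℝ≥0∞) ^ m ≤ ‖B (dyad (j + 1) m) ω - B (dyad j m) ω‖ₑ}
  have hlarge m j : P (large m j) ≤ ((2⁻¹ ^ m) ^ 2 / (ρ ^ m) ^ 4 : ℝ≥0) * M := by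
    simpa using measure_le_enorm_le_of_hasLaw_gaussianReal (hB.hasLaw_increment j m)
      (pow_ne_zero m hρ0)
  have hunion m : P (⋃ j ∈ Finset.range ((m + 3) * 2 ^ m), large m j)
      ≤ ((m + 3) * (2 * ρ ^ 4)⁻¹ ^ m : ℝ≥0) * M :=
    calc _ ≤ ∑ j ∈ Finset.range ((m + 3) * 2 ^ m), P (large m j) := measure_biUnion_finset_le _ _
      _ ≤ ∑ j ∈ Finset.range ((m + 3) * 2 ^ m), ((2⁻¹ ^ m) ^ 2 / (ρ ^ m) ^ 4 : ℝ≥0) * M :=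
        by gcongr; exact hlarge m _
      _ = (((m + 3) * 2 ^ m) * ((2⁻¹ ^ m) ^ 2 / (ρ ^ m) ^ 4) : ℝ≥0) * M := by
        rw [Finset.sum_const, Finset.card_range, nsmul_eq_mul, ← mul_assoc]
        push_cast
        rfl
      _ = ((m + 3) * (2 * ρ ^ 4)⁻¹ ^ m : ℝ≥0) * M := by
        rw [mul_assoc, pow_right_comm 2⁻¹, pow_right_comm ρ, ← div_pow, ← mul_pow,
          show 2 * (2⁻¹ ^ 2 / ρ ^ 4) = (2 * ρ ^ 4)⁻¹ by field_simp]
  have hsum : ∑' m, P (⋃ j ∈ Finset.range ((m + 3) * 2 ^ m), large m j) ≠ ∞ := by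
    refine ne_top_of_le_ne_top ?_ (ENNReal.tsum_le_tsum hunion)
    rw [ENNReal.tsum_mul_right]
    exact ENNReal.mul_ne_top (ENNReal.tsum_coe_ne_top_iff_summable.2
      (summable_add_const_mul_geometric (inv_lt_one_of_one_lt₀ hρ) 3))
      (lintegral_enorm_pow_gaussianReal_ne_top 0 1 4)
  filter_upwards [ae_eventually_notMem hsum] with ω hω
  filter_upwards [hω] with m hm j hj
  rw [edist_eq_enorm_sub]
  simp only [large, Set.mem_iUnion, Finset.mem_range, not_exists] at hm
  exact (not_le.1 (hm j hj)).le

theorem IsDyadicBrownian.measure_oscEvent (hB : IsDyadicBrownian B P) : P (oscEvent B) = 0 := by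
  -- Any `ρ < 1` with `2 * ρ ^ 4 > 1` would do.
  have hρ : (1 : ℝ≥0) < 2 * (9 / 10) ^ 4 := by rw [← NNReal.coe_lt_coe]; norm_num
  rw [measure_eq_zero_iff_ae_notMem]
  filter_upwards [hB.ae_eventually_increments_le hρ] with ω hω
  exact notMem_oscEvent_of_eventually_increments_le (by rw [← NNReal.coe_lt_coe]; norm_num) hω

end BorelCantelli

section DyadicRight

theorem dyadicRight_le (t : ℝ≥0) : dyadicRight t ≤ comap (↑) (𝓝 t) :=
  comap_mono nhdsWithin_le_nhds

instance dyadicRight_neBot (t : ℝ≥0) : (dyadicRight t).NeBot := by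
  refine comap_neBot fun u hu ↦ ?_
  obtain ⟨c, hc, hcu⟩ := mem_nhdsGT_iff_exists_Ioo_subset.1 hu
  obtain ⟨r, hr, htr⟩ := dense_dyadics.exists_between hc
  exact ⟨⟨r, hr⟩, hcu htr⟩

instance dyadicRight_isCountablyGenerated (t : ℝ≥0) : (dyadicRight t).IsCountablyGenerated := by
  unfold dyadicRight
  infer_instance

end DyadicRight

section PathRegularity

variable {Ω : Type*} {B : dyadics → Ω → ℝ} {ω : Ω}

theorem edist_le_maxOsc {k n : ℕ} (hk : k ≤ (n + 1) * 2 ^ n) {r : dyadics}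
    (hr : r ∈ Set.Icc (dyad k n) (dyad (k + 2) n)) :
    edist (B r ω) (B (dyad k n) ω) ≤ maxOsc B n ω :=
  calc edist (B r ω) (B (dyad k n) ω) ≤ localOsc B k n ω := by
        rw [localOsc_eq_iSup_edist]
        exact le_iSup₂ (f := fun r _ ↦ edist (B r ω) (B (dyad k n) ω)) r hr
    _ ≤ maxOsc B n ω := le_iSup₂ (f := fun k _ ↦ localOsc B k n ω) k hk

theorem edist_le_two_mul_maxOsc {n : ℕ} {r s : dyadics} (hr : (r : ℝ≥0) ≤ n + 1) (hrs : r ≤ s)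
    (hs : (s : ℝ≥0) ≤ r + dyad 1 n) : edist (B r ω) (B s ω) ≤ 2 * maxOsc B n ω := by
  set k := ⌊(r : ℝ≥0) * 2 ^ n⌋₊
  have hk : k ≤ (n + 1) * 2 ^ n :=
    Nat.floor_le_of_le (by push_cast; gcongr)
  have hkr : dyad k n ≤ r := dyad_floor_le r n
  have hsk : s ≤ dyad (k + 2) n := Subtype.coe_le_coe.1 <|
    calc (s : ℝ≥0) ≤ r + dyad 1 n := hs
      _ ≤ dyad (k + 1) n + dyad 1 n := by gcongr; exact (lt_dyad_floor_add_one r n).le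
      _ = dyad (k + 2) n := (coe_dyad_add (k + 1) 1 n).symm
  rw [two_mul]
  exact (edist_triangle_right _ _ (B (dyad k n) ω)).trans
    (add_le_add (edist_le_maxOsc hk ⟨hkr, hrs.trans hsk⟩) (edist_le_maxOsc hk ⟨hkr.trans hrs, hsk⟩))

theorem uniformContinuousOn_of_notMem_oscEvent (hω : ω ∉ oscEvent B) (t : ℝ≥0) :
    UniformContinuousOn (fun r ↦ B r ω) {r : dyadics | (r : ℝ≥0) ≤ t} := by
  rw [EMetric.uniformContinuousOn_iff]
  intro ε hε
  have hosc : ∀ᶠ n : ℕ in atTop, maxOsc B n ω ≤ (n : ℝ≥0∞)⁻¹ := by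
    simpa only [oscEvent, Set.mem_ofPred_eq, not_frequently, not_lt] using hω
  have hinv : ∀ᶠ n : ℕ in atTop, 2 * (n : ℝ≥0∞)⁻¹ < ε := by
    have h := ENNReal.Tendsto.const_mul (a := 2) ENNReal.tendsto_inv_nat_nhds_zero (by simp)
    rw [mul_zero] at h
    exact h.eventually_lt_const hε
  obtain ⟨n, hn, hnε, htn⟩ := (hosc.and (hinv.and (eventually_ge_atTop ⌈t⌉₊))).exists
  have ht : t ≤ n + 1 := (Nat.ceil_le.1 htn).trans le_self_add
  have hbound : 2 * maxOsc B n ω < ε := (mul_le_mul_right hn 2).trans_lt hnε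
  refine ⟨(dyad 1 n : ℝ≥0), by simp [coe_dyad], fun {r} hr {s} hs hrs ↦ ?_⟩
  rw [edist_nndist, ENNReal.coe_lt_coe, Subtype.nndist_eq, NNReal.nndist_eq, max_lt_iff] at hrs
  rcases le_total r s with h | h
  · exact (edist_le_two_mul_maxOsc (hr.trans ht) h (tsub_le_iff_left.1 hrs.2.le)).trans_lt hbound
  · rw [edist_comm]
    exact (edist_le_two_mul_maxOsc (hs.trans ht) h (tsub_le_iff_left.1 hrs.1.le)).trans_lt hbound

theorem exists_tendsto_of_notMem_oscEvent (hω : ω ∉ oscEvent B) (t : ℝ≥0) :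
    ∃ c, Tendsto (fun r ↦ B r ω) (comap (↑) (𝓝 t)) (𝓝 c) :=
  exists_tendsto_of_uniformContinuousOn_of_dense dense_dyadics (Iic_mem_nhds (lt_add_one t))
    (uniformContinuousOn_of_notMem_oscEvent hω (t + 1))

theorem limitExtension_eq_extend (hω : ω ∉ oscEvent B) :
    (limitExtension B · ω) = dense_dyadics.extend (B · ω) := by
  funext t
  obtain ⟨c, hc⟩ := exists_tendsto_of_notMem_oscEvent hω t
  rw [dense_dyadics.extend_eq_of_tendsto hc]
  exact (hc.mono_left (dyadicRight_le t)).limUnder_eq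

theorem tendsto_limitExtension (hω : ω ∉ oscEvent B) (t : ℝ≥0) :
    Tendsto (fun r ↦ B r ω) (dyadicRight t) (𝓝 (limitExtension B t ω)) :=
  let ⟨c, hc⟩ := exists_tendsto_of_notMem_oscEvent hω t
  tendsto_nhds_limUnder ⟨c, hc.mono_left (dyadicRight_le t)⟩

theorem limitExtension_coe (hω : ω ∉ oscEvent B) (r : dyadics) :
    limitExtension B r ω = B r ω := by
  rw [congrFun (limitExtension_eq_extend hω) r]
  exact dense_dyadics.isDenseInducing_val.extend_eq' (exists_tendsto_of_notMem_oscEvent hω) r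

theorem continuous_limitExtension (hω : ω ∉ oscEvent B) :
    Continuous fun t ↦ limitExtension B t ω := by
  rw [limitExtension_eq_extend hω]
  exact dense_dyadics.continuous_extend (exists_tendsto_of_notMem_oscEvent hω)

end PathRegularity

section BrownianLimit

variable {Ω : Type*} [MeasurableSpace Ω] {P : Measure Ω} {B : dyadics → Ω → ℝ}

theorem isPreBrownianReal_of_ae_tendsto {κ : Type*} {l : Filter κ} [l.IsCountablyGenerated]
    [l.NeBot] {W : ℝ≥0 → Ω → ℝ} {Y : κ → ℝ≥0 → Ω → ℝ} (hY : ∀ n, IsGaussianProcess (Y n) P)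
    (h0 : ∀ n t, P[Y n t] = 0)
    (hc : ∀ s t, Tendsto (fun n ↦ cov[Y n s, Y n t; P]) l (𝓝 (min s t : ℝ≥0)))
    (hlim : ∀ t, ∀ᵐ ω ∂P, Tendsto (Y · t ω) l (𝓝 (W t ω))) : IsPreBrownianReal W P where
  hasLaw I := by
    refine hasLaw_pi_of_ae_tendsto_of_hasGaussianLaw (W := fun (i : I) ↦ W i)
      (Y := fun n (i : I) ↦ Y n i) (fun n ↦ (hY n).hasGaussianLaw I) (fun i ↦ ?_) (fun i j ↦ ?_)
      fun i ↦ hlim i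
    · simp only [h0, BrownianReal.integral_eval_projectiveFamily, tendsto_const_nhds]
    · rw [BrownianReal.covariance_eval_projectiveFamily]
      exact hc i j

theorem IsDyadicBrownian.isPreBrownianReal_of_ae_tendsto_comp (hB : IsDyadicBrownian B P)
    {d : ℕ → ℝ≥0 → dyadics} (hd : ∀ t, Tendsto (fun n ↦ (d n t : ℝ≥0)) atTop (𝓝 t))
    {W : ℝ≥0 → Ω → ℝ} (hW : ∀ t, ∀ᵐ ω ∂P, Tendsto (fun n ↦ B (d n t) ω) atTop (𝓝 (W t ω))) :
    IsPreBrownianReal W P := by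
  refine isPreBrownianReal_of_ae_tendsto (Y := fun n t ↦ B (d n t))
    (fun n ↦ hB.isGaussianProcess.comp_right (d n)) (fun n t ↦ hB.integral_eq_zero _)
    (fun s t ↦ ?_) hW
  simp only [hB.covariance_eq_min, (Subtype.mono_coe (· ∈ dyadics)).map_min]
  exact NNReal.tendsto_coe.2 ((hd s).min (hd t))

theorem IsDyadicBrownian.isBrownianReal_limitExtension (hB : IsDyadicBrownian B P) :
    IsBrownianReal (limitExtension B) P := by
  have hN : ∀ᵐ ω ∂P, ω ∉ oscEvent B := measure_eq_zero_iff_ae_notMem.1 hB.measure_oscEvent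
  choose d hd using fun t : ℝ≥0 ↦ exists_seq_tendsto (dyadicRight t)
  refine ⟨hB.isPreBrownianReal_of_ae_tendsto_comp (d := fun n t ↦ d t n)
    (fun t ↦ tendsto_comap.comp ((hd t).mono_right (dyadicRight_le t))) fun t ↦ ?_, ?_⟩
  · filter_upwards [hN] with ω hω using (tendsto_limitExtension hω t).comp (hd t)
  · filter_upwards [hN] with ω hω using continuous_limitExtension hω

end BrownianLimit

theorem mainTheorem2 {Ω : Type*} [MeasurableSpace Ω] (P : Measure Ω) [IsProbabilityMeasure P] :
    -- the process built from independent standard normal variables is Brownian on `D`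
    (∀ X : dyadics → Ω → ℝ, iIndepFun X P → (∀ r, HasLaw (X r) (gaussianReal 0 1) P) →
      IsDyadicBrownian (midpointProcess X) P) ∧
    -- every Brownian motion on `D` extends to a standard Brownian motion
    (∀ B : dyadics → Ω → ℝ, IsDyadicBrownian B P →
      P (oscEvent B) = 0 ∧
      (∀ ω ∉ oscEvent B,
        (∀ t : ℝ≥0, UniformContinuousOn (fun r => B r ω) {r : dyadics | (r : ℝ≥0) ≤ t}) ∧
        (∀ t : ℝ≥0, Tendsto (fun r => B r ω) (dyadicRight t) (𝓝 (limitExtension B t ω))) ∧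
        (∀ r : dyadics, limitExtension B r ω = B r ω) ∧
        Continuous (fun t => limitExtension B t ω)) ∧
      (∀ I : Finset dyadics,
        P.map (fun ω (r : I) => limitExtension B (r : dyadics) ω)
          = P.map (fun ω (r : I) => B r ω)) ∧
      IsBrownianReal (limitExtension B) P) := by
  refine ⟨fun X hX hlaw ↦ isDyadicBrownian_midpointProcess hX hlaw, fun B hB ↦
    ⟨hB.measure_oscEvent, fun ω hω ↦ ⟨uniformContinuousOn_of_notMem_oscEvent hω,
      tendsto_limitExtension hω, limitExtension_coe hω, continuous_limitExtension hω⟩,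
      fun I ↦ Measure.map_congr ?_, hB.isBrownianReal_limitExtension⟩⟩
  filter_upwards [measure_eq_zero_iff_ae_notMem.1 hB.measure_oscEvent] with ω hω
  exact funext fun r ↦ limitExtension_coe hω r
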